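/- For integers $n\ge 1$, let $\mathbb{S}^n$ be the unit sphere of $\mathbb{R}^{n+1}$, with its volume measure $\mu_{\mathbb{S}^n}$ normalized to total mass $1$ and with the geodesic distance $d(x,y)=\arccos\langle x,y\rangle$. For $0\le k\le n$ regard $\mathbb{S}^k$ as the great subsphere of $\mathbb{S}^n$ on which the last $n-k$ coordinates vanish, and for $r>0$ let $(\mathbb{S}^k)_r=\{x\in\mathbb{S}^n \mid d(x,y)<r \text{ for some } y\in\mathbb{S}^k\}$ be its open $r$-neighbourhood. For integers $m\ge 1$ put $$A_m=1+\frac{\sqrt{\pi}\,e^{(9m-3)/(4m-2)}}{2}\left\{2+e^{1/(4m-2)}\right\},\qquad \widetilde A_m=1+\frac{\sqrt{\pi}\,e^{(m+1)/(4m-2)}}{2}\left\{2+e^{1/(4m-2)}\right\},$$ $$B_m=1+\sqrt{\pi}\,e^{\pi^2+(m+1)/(4m-2)},\qquad \widetilde B_m=1+\sqrt{\pi}\,e^{(m+1)/(4m-2)}.$$ Corollary. Let $1\le m\le n$ be integers. Then, for every $r>0$, $$\mu_{\mathbb{S}^n}\bigl(\mathbb{S}^n\setminus(\mathbb{S}^{n-m})_r\bigr)\le\min\Bigl\{A_m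 e^{-\frac{1}{3\pi}\sqrt{2n/m}\,r},\ \widetilde A_m e^{-\frac{1}{3\pi}\sqrt{n/(2m)}\,r},\ B_m e^{-\frac{n-1}{4\pi^2 m}r^2},\ \widetilde B_m e^{-\frac{n-1}{8\pi^2 m}r^2}\Bigr\}.$$ -/

import Mathlib

open MeasureTheory

noncomputable section

/-- The standard unit sphere `S^n` in `ℝ^(n+1)`. -/
abbrev UnitSphere (n : ℕ) : Type :=
  Metric.sphere (0 : EuclideanSpace ℝ (Fin (n + 1))) 1

/-- The volume (surface) measure of `S^n`, normalized to have total mass `1`. -/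
def sphereMeasure (n : ℕ) : Measure (UnitSphere n) :=
  ((volume : Measure (EuclideanSpace ℝ (Fin (n + 1)))).toSphere Set.univ)⁻¹ •
    (volume : Measure (EuclideanSpace ℝ (Fin (n + 1)))).toSphere

/-- The geodesic (great-circle) distance of the round sphere, `arccos ⟪x, y⟫`. -/
def geodesicDist {n : ℕ} (x y : UnitSphere n) : ℝ :=
  Real.arccos (inner ℝ (x : EuclideanSpace ℝ (Fin (n + 1))) (y : EuclideanSpace ℝ (Fin (n + 1))))

/-- The sphere `S^k` as a great subsphere of `S^n`, through the natural inclusion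
`ℝ^(k+1) = ℝ^(k+1) × {0} ⊆ ℝ^(n+1)`. -/
def greatSubsphere (k n : ℕ) : Set (UnitSphere n) :=
  {x | ∀ i : Fin (n + 1), k < (i : ℕ) → (x : EuclideanSpace ℝ (Fin (n + 1))) i = 0}

/-- The open `r`-neighbourhood of a subset of `S^n` for the geodesic distance. -/
def openNeighbourhood {n : ℕ} (r : ℝ) (S : Set (UnitSphere n)) : Set (UnitSphere n) :=
  {x | ∃ y ∈ S, geodesicDist x y < r}

/-- The constant `A_m`. -/
def constA (m : ℕ) : ℝ :=
  1 + Real.sqrt Real.pi * Real.exp ((9 * (m : ℝ) - 3) / (4 * (m : ℝ) - 2)) / 2 *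
    (2 + Real.exp (1 / (4 * (m : ℝ) - 2)))

/-- The constant `Ã_m`. -/
def constATilde (m : ℕ) : ℝ :=
  1 + Real.sqrt Real.pi * Real.exp (((m : ℝ) + 1) / (4 * (m : ℝ) - 2)) / 2 *
    (2 + Real.exp (1 / (4 * (m : ℝ) - 2)))

/-- The constant `B_m`. -/
def constB (m : ℕ) : ℝ :=
  1 + Real.sqrt Real.pi * Real.exp (Real.pi ^ 2 + ((m : ℝ) + 1) / (4 * (m : ℝ) - 2))

/-- The constant `B̃_m`. -/
def constBTilde (m : ℕ) : ℝ :=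
  1 + Real.sqrt Real.pi * Real.exp (((m : ℝ) + 1) / (4 * (m : ℝ) - 2))

end

open scoped ENNReal

/-! A single Gaussian-type bound implies all four. If a positive diagonal form `Q(x) = ∑ b i * x i ^
2` is at most `1` on a subset `S` of the sphere, then `exp (-Q) ≥ exp (-‖x‖ ^ 2)` on the cone over
`S`; comparing Gaussian integrals in polar coordinates bounds the measure of `S` by `∏ 1 / √(b i)`
(`sphereMeasure_le_prod_of_sum_mul_sq_le`). Points at distance at least `r` from the subsphere have
large mass in the last `m` coordinates, so a form slightly smaller there and slightly larger
elsewhere gives `√2 * exp (-(n + 1) r² / (2π² m))`. -/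

/-- Integration in polar coordinates. -/
theorem lintegral_eq_lintegral_toSphere_prod {E : Type*} [NormedAddCommGroup E] [NormedSpace ℝ E]
    [MeasurableSpace E] [BorelSpace E] [FiniteDimensional ℝ E] [Nontrivial E]
    (μ : Measure E) [μ.IsAddHaarMeasure] (f : E → ℝ≥0∞) :
    ∫⁻ x, f x ∂μ = ∫⁻ p, f ((p.2 : ℝ) • (p.1 : E))
      ∂(μ.toSphere.prod (Measure.volumeIoiPow (Module.finrank ℝ E - 1))) := by
  rw [← μ.measurePreserving_homeomorphUnitSphereProd.lintegral_comp_emb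
    (Homeomorph.measurableEmbedding _)]
  have h : ∀ x : ({0}ᶜ : Set E), f (((homeomorphUnitSphereProd E x).2 : ℝ) •
      ((homeomorphUnitSphereProd E x).1 : E)) = f x := by
    intro x
    have := congrArg Subtype.val ((homeomorphUnitSphereProd E).symm_apply_apply x)
    exact congrArg f this
  simp_rw [h]
  rw [lintegral_subtype_comap (measurableSet_singleton _).compl, restrict_compl_singleton]

theorem lintegral_exp_neg_sum_mul_sq {ι : Type*} [Fintype ι] (b : ι → ℝ) (hb : ∀ i, 0 < b i) :
    ∫⁻ x : EuclideanSpace ℝ ι, ENNReal.ofReal (Real.exp (-∑ i, b i * x i ^ 2)) =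
      ENNReal.ofReal (∏ i, Real.sqrt (Real.pi / b i)) := by
  have h : ∀ x : ι → ℝ, Real.exp (-∑ i, b i * x i ^ 2) =
      ∏ i, Real.exp (-b i * x i ^ 2) := by
    intro x
    rw [← Real.exp_sum, ← Finset.sum_neg_distrib]
    simp only [neg_mul]
  have hm : Measurable fun x : ι → ℝ ↦ ENNReal.ofReal (Real.exp (-∑ i, b i * x i ^ 2)) := by
    fun_prop
  rw [(PiLp.volume_preserving_ofLp ι).lintegral_comp hm]
  simp_rw [h]
  rw [← ofReal_integral_eq_lintegral_ofReal, integral_fintype_prod_volume_eq_prod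
    (fun i (t : ℝ) ↦ Real.exp (-b i * t ^ 2))]
  · simp_rw [integral_gaussian]
  · exact Integrable.fintype_prod (f := fun i (t : ℝ) ↦ Real.exp (-b i * t ^ 2))
      fun i ↦ integrable_exp_neg_mul_sq (hb i)
  · exact .of_forall fun x ↦ Finset.prod_nonneg fun i _ ↦ (Real.exp_pos _).le

/-- The radial Gaussian integral `J` is a common factor of the two sides and cancels, so it is never
computed. -/
theorem sphereMeasure_le_prod_of_sum_mul_sq_le {n : ℕ} (b : Fin (n + 1) → ℝ) (hb : ∀ i, 0 < b i) :
    sphereMeasure n {x | ∑ i, b i * (x : EuclideanSpace ℝ (Fin (n + 1))) i ^ 2 ≤ 1} ≤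
      ENNReal.ofReal (∏ i, 1 / Real.sqrt (b i)) := by
  set S : Set (UnitSphere n) := {x | ∑ i, b i * (x : EuclideanSpace ℝ (Fin (n + 1))) i ^ 2 ≤ 1}
  set V : Measure (EuclideanSpace ℝ (Fin (n + 1))) := volume
  set ν := Measure.volumeIoiPow (Module.finrank ℝ (EuclideanSpace ℝ (Fin (n + 1))) - 1)
  have hS : MeasurableSet S := by
    have : Continuous fun x : UnitSphere n ↦
      ∑ i, b i * (x : EuclideanSpace ℝ (Fin (n + 1))) i ^ 2 := by fun_prop
    exact (isClosed_le this continuous_const).measurableSet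
  set J := ∫⁻ t : Set.Ioi (0 : ℝ), ENNReal.ofReal (Real.exp (-(t : ℝ) ^ 2)) ∂ν
  have hJm : Measurable fun t : Set.Ioi (0 : ℝ) ↦ ENNReal.ofReal (Real.exp (-(t : ℝ) ^ 2)) := by
    fun_prop
  have hscale : ∀ (c : Fin (n + 1) → ℝ) (p : UnitSphere n × Set.Ioi (0 : ℝ)),
      ∑ i, c i * ((p.2 : ℝ) • (p.1 : EuclideanSpace ℝ (Fin (n + 1)))) i ^ 2 =
      (p.2 : ℝ) ^ 2 * ∑ i, c i * (p.1 : EuclideanSpace ℝ (Fin (n + 1))) i ^ 2 := by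
    intro c p
    rw [Finset.mul_sum]
    refine Finset.sum_congr rfl fun i _ ↦ ?_
    simp only [PiLp.smul_apply, smul_eq_mul]
    ring
  have hnorm : ∀ x : UnitSphere n, ∑ i, (x : EuclideanSpace ℝ (Fin (n + 1))) i ^ 2 = 1 := by
    intro x
    rw [← EuclideanSpace.real_norm_sq_eq, norm_eq_of_mem_sphere, one_pow]
  have huniv : V.toSphere Set.univ * J = ENNReal.ofReal (∏ _i : Fin (n + 1), Real.sqrt Real.pi) := by
    have := lintegral_exp_neg_sum_mul_sq (fun _ : Fin (n + 1) ↦ (1 : ℝ)) (fun _ ↦ one_pos)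
    rw [lintegral_eq_lintegral_toSphere_prod] at this
    simp_rw [hscale, one_mul, hnorm, mul_one, div_one] at this
    rw [← this]
    refine Eq.trans ?_ (lintegral_prod (μ := V.toSphere) (ν := ν) _
      (hJm.comp measurable_snd).aemeasurable).symm
    simp only [Function.comp_apply, lintegral_const]
    rw [mul_comm]
  have hle : V.toSphere S * J ≤ ENNReal.ofReal (∏ i, Real.sqrt (Real.pi / b i)) := by
    rw [← lintegral_exp_neg_sum_mul_sq b hb, lintegral_eq_lintegral_toSphere_prod]
    have h1 : V.toSphere S * J = ∫⁻ p : UnitSphere n × Set.Ioi (0 : ℝ),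
        S.indicator (fun _ ↦ 1) p.1 * ENNReal.ofReal (Real.exp (-(p.2 : ℝ) ^ 2))
          ∂(V.toSphere.prod ν) := by
      rw [lintegral_prod_mul (measurable_const.indicator hS).aemeasurable hJm.aemeasurable,
        lintegral_indicator_const hS, one_mul]
    rw [h1]
    refine lintegral_mono fun p ↦ ?_
    rw [hscale]
    by_cases hp : p.1 ∈ S
    · rw [Set.indicator_of_mem hp, one_mul]
      refine ENNReal.ofReal_le_ofReal (Real.exp_le_exp.2 (neg_le_neg ?_))
      exact mul_le_of_le_one_right (sq_nonneg _) hp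
    · simp [hp]
  have hpi : 0 < ∏ _i : Fin (n + 1), Real.sqrt Real.pi :=
    Finset.prod_pos fun i _ ↦ Real.sqrt_pos.2 Real.pi_pos
  -- Nonvanishing and finiteness of `J` are read off from `huniv`, whose right side is positive and
  -- finite.
  have hJ0 : J ≠ 0 := by
    intro h
    rw [h, mul_zero] at huniv
    exact (ENNReal.ofReal_pos.2 hpi).ne huniv
  have hU0 : V.toSphere Set.univ ≠ 0 := by
    intro h
    rw [h, zero_mul] at huniv
    exact (ENNReal.ofReal_pos.2 hpi).ne huniv
  have hJtop : J ≠ ∞ := by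
    intro h
    rw [h, ENNReal.mul_top hU0] at huniv
    exact ENNReal.ofReal_ne_top huniv.symm
  calc sphereMeasure n S = V.toSphere S / V.toSphere Set.univ := by
        rw [sphereMeasure, Measure.smul_apply, smul_eq_mul, mul_comm, ENNReal.div_eq_inv_mul,
          mul_comm]
    _ = (V.toSphere S * J) / (V.toSphere Set.univ * J) :=
        (ENNReal.mul_div_mul_right _ _ hJ0 hJtop).symm
    _ ≤ ENNReal.ofReal (∏ i, Real.sqrt (Real.pi / b i)) /
          ENNReal.ofReal (∏ _i : Fin (n + 1), Real.sqrt Real.pi) := by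
        rw [huniv]
        gcongr
    _ = ENNReal.ofReal (∏ i, 1 / Real.sqrt (b i)) := by
        rw [← ENNReal.ofReal_div_of_pos hpi, ← Finset.prod_div_distrib]
        congr 1
        refine Finset.prod_congr rfl fun i _ ↦ ?_
        rw [Real.sqrt_div Real.pi_pos.le]
        have := Real.sqrt_pos.2 Real.pi_pos
        have := Real.sqrt_pos.2 (hb i)
        field_simp

/-! ### Concentration in terms of the last `m` coordinates -/

theorem exp_half_le_one_add {y : ℝ} (h0 : 0 ≤ y) (h1 : y ≤ 1) : Real.exp (y / 2) ≤ 1 + y := by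
  refine (Real.exp_bound_div_one_sub_of_interval (by linarith) (by linarith)).trans ?_
  rw [div_le_iff₀ (by linarith)]
  nlinarith

theorem card_filter_sub_lt {m n : ℕ} (hmn : m ≤ n) :
    (Finset.univ.filter fun i : Fin (n + 1) ↦ n - m < (i : ℕ)).card = m := by
  have := Fin.card_filter_val_lt (n := n + 1) (m := n - m + 1)
  have h2 := Finset.card_filter_add_card_filter_not (s := (Finset.univ : Finset (Fin (n + 1))))
    (fun i : Fin (n + 1) ↦ (i : ℕ) < n - m + 1)
  have h3 : (Finset.univ.filter fun i : Fin (n + 1) ↦ ¬ (i : ℕ) < n - m + 1) =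
      Finset.univ.filter fun i : Fin (n + 1) ↦ n - m < (i : ℕ) := by
    ext i; simp
  rw [h3, this, Finset.card_univ, Fintype.card_fin] at h2
  omega

theorem sphereMeasure_sq_le_sum_sq_le {m n : ℕ} (hm : 1 ≤ m) (hmn : m ≤ n) {s : ℝ} (hs0 : 0 ≤ s)
    (hs1 : s ≤ 1) :
    sphereMeasure n {x | s ^ 2 ≤ ∑ i : Fin (n + 1),
        if n - m < (i : ℕ) then (x : EuclideanSpace ℝ (Fin (n + 1))) i ^ 2 else 0} ≤
      ENNReal.ofReal (Real.sqrt 2 * Real.exp (-((n + 1) * s ^ 2 / (8 * m)))) := by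
  have hm' : (1 : ℝ) ≤ m := by exact_mod_cast hm
  -- With this `a`, Bernoulli gives `(1 - a) ^ m ≥ 1 - m * a = 1 / 2`, the source of the factor
  -- `√2`.
  obtain ⟨a, ha⟩ : ∃ a : ℝ, a = 1 / (2 * m) := ⟨_, rfl⟩
  have ha0 : 0 < a := by rw [ha]; positivity
  have ham : m * a = 1 / 2 := by rw [ha]; field_simp
  have ha1 : a ≤ 1 / 2 := by nlinarith
  have hs2 : s ^ 2 ≤ 1 := by nlinarith
  have has : 0 ≤ a * s ^ 2 := by positivity
  let c : Fin (n + 1) → ℝ := fun i ↦ if n - m < (i : ℕ) then 1 - a else 1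
  -- On the sphere the form is `1 + a * (s ^ 2 - ∑ last x i ^ 2)`, at most `1` exactly on the given
  -- set.
  let b : Fin (n + 1) → ℝ := fun i ↦ 1 + a * s ^ 2 - if n - m < (i : ℕ) then a else 0
  have hc : ∀ i, 0 < c i := by
    intro i; simp only [c]; split_ifs <;> linarith
  have hcb : ∀ i, (1 + a * s ^ 2) * c i ≤ b i := by
    intro i; simp only [c, b]; split_ifs <;> nlinarith
  have hcp : ∀ i, 0 < (1 + a * s ^ 2) * c i := fun i ↦ mul_pos (by linarith) (hc i)
  have hb : ∀ i, 0 < b i := fun i ↦ (hcp i).trans_le (hcb i)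
  have hprodc : 1 / 2 ≤ ∏ i, c i := by
    simp only [c]
    rw [Finset.prod_ite, Finset.prod_const, Finset.prod_const_one, card_filter_sub_lt hmn, mul_one]
    have := one_add_mul_le_pow (a := -a) (by linarith) m
    rw [← sub_eq_add_neg] at this
    linarith
  have hprod : Real.exp ((n + 1) * s ^ 2 / (4 * m)) / 2 ≤ ∏ i, ((1 + a * s ^ 2) * c i) := by
    rw [Finset.prod_mul_distrib, Finset.prod_const, Finset.card_univ, Fintype.card_fin]
    have h1 : Real.exp ((n + 1) * s ^ 2 / (4 * m)) ≤ (1 + a * s ^ 2) ^ (n + 1) := by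
      have := exp_half_le_one_add has (by nlinarith)
      calc Real.exp ((n + 1) * s ^ 2 / (4 * m)) = Real.exp (a * s ^ 2 / 2) ^ (n + 1) := by
            rw [← Real.exp_nat_mul, ha]
            push_cast
            congr 1
            field_simp
            ring
        _ ≤ _ := by gcongr
    calc _ = Real.exp ((n + 1) * s ^ 2 / (4 * m)) * (1 / 2) := by ring
      _ ≤ _ := by gcongr
  refine le_trans (measure_mono ?_) ((sphereMeasure_le_prod_of_sum_mul_sq_le b hb).trans
    (ENNReal.ofReal_le_ofReal ?_))
  · intro x hx
    have hnorm : ∑ i, (x : EuclideanSpace ℝ (Fin (n + 1))) i ^ 2 = 1 := by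
      rw [← EuclideanSpace.real_norm_sq_eq, norm_eq_of_mem_sphere, one_pow]
    have hsum : ∑ i, b i * (x : EuclideanSpace ℝ (Fin (n + 1))) i ^ 2 = (1 + a * s ^ 2) *
        (∑ i, (x : EuclideanSpace ℝ (Fin (n + 1))) i ^ 2) - a * ∑ i : Fin (n + 1),
        if n - m < (i : ℕ) then (x : EuclideanSpace ℝ (Fin (n + 1))) i ^ 2 else 0 := by
      rw [Finset.mul_sum, Finset.mul_sum, ← Finset.sum_sub_distrib]
      refine Finset.sum_congr rfl fun i _ ↦ ?_
      simp only [b]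
      split_ifs <;> ring
    simp only [Set.mem_ofPred_eq] at hx ⊢
    rw [hsum, hnorm]
    nlinarith
  · calc ∏ i, 1 / Real.sqrt (b i) ≤ ∏ i, 1 / Real.sqrt ((1 + a * s ^ 2) * c i) := by
          refine Finset.prod_le_prod (fun i _ ↦ by positivity) fun i _ ↦ ?_
          exact one_div_le_one_div_of_le (Real.sqrt_pos.2 (hcp i)) (Real.sqrt_le_sqrt (hcb i))
      _ = 1 / Real.sqrt (∏ i, ((1 + a * s ^ 2) * c i)) := by
          rw [Real.sqrt_prod _ fun i _ ↦ (hcp i).le, Finset.prod_div_distrib, Finset.prod_const_one]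
      _ ≤ 1 / Real.sqrt (Real.exp ((n + 1) * s ^ 2 / (4 * m)) / 2) :=
          one_div_le_one_div_of_le (Real.sqrt_pos.2 (by positivity)) (Real.sqrt_le_sqrt hprod)
      _ = Real.sqrt 2 * Real.exp (-((n + 1) * s ^ 2 / (8 * m))) := by
          rw [Real.sqrt_div (Real.exp_pos _).le, one_div_div, ← Real.exp_half, div_eq_mul_inv,
            ← Real.exp_neg]
          congr 3
          field_simp
          ring

/-! ### Geometry of the neighbourhood -/

/-- The distance to the subsphere is `arccos ‖q‖`, with `q` the orthogonal projection of `x`, so the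
remaining coordinates have mass `1 - ‖q‖ ^ 2 ≥ sin r ^ 2`; Jordan's inequality finishes. -/
theorem compl_openNeighbourhood_greatSubsphere_subset {k n : ℕ} {r : ℝ} (hr : 0 < r)
    {x : UnitSphere n} (hx : x ∉ openNeighbourhood r (greatSubsphere k n)) :
    r ≤ Real.pi / 2 ∧ (2 * r / Real.pi) ^ 2 ≤ ∑ i : Fin (n + 1),
      if k < (i : ℕ) then (x : EuclideanSpace ℝ (Fin (n + 1))) i ^ 2 else 0 := by
  let q : EuclideanSpace ℝ (Fin (n + 1)) :=
    WithLp.toLp 2 fun i ↦ if k < (i : ℕ) then 0 else (x : EuclideanSpace ℝ (Fin (n + 1))) i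
  have hinner : inner ℝ (x : EuclideanSpace ℝ (Fin (n + 1))) q = ‖q‖ ^ 2 := by
    rw [EuclideanSpace.real_norm_sq_eq, PiLp.inner_apply]
    refine Finset.sum_congr rfl fun i _ ↦ ?_
    simp only [q]
    split_ifs <;> simp [sq]
  have hq : ‖q‖ ^ 2 + (∑ i : Fin (n + 1),
      if k < (i : ℕ) then (x : EuclideanSpace ℝ (Fin (n + 1))) i ^ 2 else 0) = 1 := by
    have hnorm : ∑ i, (x : EuclideanSpace ℝ (Fin (n + 1))) i ^ 2 = 1 := by
      rw [← EuclideanSpace.real_norm_sq_eq, norm_eq_of_mem_sphere, one_pow]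
    refine Eq.trans ?_ hnorm
    rw [EuclideanSpace.real_norm_sq_eq, ← Finset.sum_add_distrib]
    refine Finset.sum_congr rfl fun i _ ↦ ?_
    simp only [q]
    split_ifs <;> simp
  have hdist : r ≤ Real.arccos ‖q‖ := by
    by_contra! hlt
    refine hx ?_
    -- The nearest point is `q / ‖q‖`; if `q = 0`, every point of the subsphere is at distance `π /
    -- 2`, and the first basis vector serves.
    rcases eq_or_ne q 0 with h0 | h0
    · refine ⟨⟨EuclideanSpace.single 0 1, by simp⟩, ?_, ?_⟩
      · intro i hi
        have : i ≠ 0 := by rintro rfl; simp at hi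
        simp [this]
      · have h00 : (x : EuclideanSpace ℝ (Fin (n + 1))) 0 = 0 := by
          have := congrArg (fun v : EuclideanSpace ℝ (Fin (n + 1)) ↦ v 0) h0
          simpa [q] using this
        rw [h0, norm_zero] at hlt
        simpa [geodesicDist, EuclideanSpace.inner_single_right, h00] using hlt
    · have hn : ‖q‖ ≠ 0 := norm_ne_zero_iff.2 h0
      refine ⟨⟨‖q‖⁻¹ • q, by simp [norm_smul, hn]⟩, ?_, ?_⟩
      · intro i hi
        simp [q, hi]
      · have : inner ℝ (x : EuclideanSpace ℝ (Fin (n + 1))) (‖q‖⁻¹ • q) = ‖q‖ := by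
          rw [inner_smul_right, hinner]
          field_simp
        simpa only [geodesicDist, this] using hlt
  have hr2 : r ≤ Real.pi / 2 := hdist.trans (Real.arccos_le_pi_div_two.2 (norm_nonneg _))
  refine ⟨hr2, ?_⟩
  have hq1 : ‖q‖ ≤ 1 := by
    by_contra! h
    rw [Real.arccos_of_one_le h.le] at hdist
    linarith
  have hcos : ‖q‖ ≤ Real.cos r := by
    rw [← Real.cos_arccos (by linarith [norm_nonneg q]) hq1]
    exact Real.cos_le_cos_of_nonneg_of_le_pi hr.le (Real.arccos_le_pi _) hdist
  have hsin : 2 * r / Real.pi ≤ Real.sin r := by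
    have := Real.mul_le_sin hr.le hr2
    rwa [div_mul_eq_mul_div] at this
  have h1 : (2 * r / Real.pi) ^ 2 ≤ Real.sin r ^ 2 :=
    pow_le_pow_left₀ (div_nonneg (by linarith) Real.pi_pos.le) hsin 2
  have h2 : ‖q‖ ^ 2 ≤ Real.cos r ^ 2 := pow_le_pow_left₀ (norm_nonneg _) hcos 2
  linarith [Real.sin_sq_add_cos_sq r]

theorem sphereMeasure_compl_openNeighbourhood_le {m n : ℕ} (hm : 1 ≤ m) (hmn : m ≤ n) {r : ℝ}
    (hr : 0 < r) :
    sphereMeasure n ((openNeighbourhood r (greatSubsphere (n - m) n))ᶜ) ≤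
      ENNReal.ofReal
        (Real.sqrt 2 * Real.exp (-((n + 1) * r ^ 2 / (2 * Real.pi ^ 2 * m)))) := by
  rcases le_or_gt r (Real.pi / 2) with h | h
  · have hpi := Real.pi_pos
    have hs1 : 2 * r / Real.pi ≤ 1 := by rw [div_le_one hpi]; linarith
    refine (measure_mono fun x hx ↦ (compl_openNeighbourhood_greatSubsphere_subset hr hx).2).trans
      ((sphereMeasure_sq_le_sum_sq_le hm hmn (by positivity) hs1).trans_eq ?_)
    congr 4
    have : (0 : ℝ) < m := by exact_mod_cast hm
    field_simp
    norm_num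
  · have : (openNeighbourhood r (greatSubsphere (n - m) n))ᶜ = ∅ :=
      Set.eq_empty_of_forall_notMem fun x hx ↦
        absurd (compl_openNeighbourhood_greatSubsphere_subset hr hx).1 (not_le.2 h)
    rw [this, measure_empty]
    exact zero_le

/-! ### Comparison with the four bounds -/

theorem sqrt_two_mul_exp_one_ninth_le : Real.sqrt 2 * Real.exp (1 / 9) ≤ 1 + Real.sqrt Real.pi := by
  have h1 : Real.exp (1 / 9) ≤ 9 / 8 :=
    (Real.exp_bound_div_one_sub_of_interval (by norm_num) (by norm_num)).trans (by norm_num)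
  have h2 : Real.sqrt 2 ≤ 3 / 2 := Real.sqrt_le_iff.2 (by norm_num)
  have h3 : 1 ≤ Real.sqrt Real.pi := Real.one_le_sqrt.2 (by linarith [Real.pi_gt_three])
  calc _ ≤ 3 / 2 * (9 / 8 : ℝ) := by gcongr
    _ ≤ _ := by linarith

/-- All four constants are at least `1 + √π`; the slack `1 / 9` is what the exponents linear in `r`
cost. -/
theorem sqrt_two_mul_exp_neg_le {C x y : ℝ} (hC : 1 + Real.sqrt Real.pi ≤ C) (hxy : y ≤ x + 1 / 9) :
    Real.sqrt 2 * Real.exp (-x) ≤ C * Real.exp (-y) := by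
  calc Real.sqrt 2 * Real.exp (-x) ≤ Real.sqrt 2 * Real.exp (1 / 9 + -y) := by
        gcongr; linarith
    _ = Real.sqrt 2 * Real.exp (1 / 9) * Real.exp (-y) := by rw [Real.exp_add, mul_assoc]
    _ ≤ C * Real.exp (-y) := by
        gcongr
        exact sqrt_two_mul_exp_one_ninth_le.trans hC

theorem one_add_sqrt_pi_le_one_add_mul_exp {u : ℝ} (hu : 0 ≤ u) :
    1 + Real.sqrt Real.pi ≤ 1 + Real.sqrt Real.pi * Real.exp u := by
  have := le_mul_of_one_le_right (Real.sqrt_nonneg Real.pi) (Real.one_le_exp hu)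
  linarith

theorem one_add_sqrt_pi_le_one_add_mul_exp_div_mul {u v : ℝ} (hu : 0 ≤ u) :
    1 + Real.sqrt Real.pi ≤ 1 + Real.sqrt Real.pi * Real.exp u / 2 * (2 + Real.exp v) := by
  refine (one_add_sqrt_pi_le_one_add_mul_exp hu).trans ?_
  have : 0 ≤ Real.sqrt Real.pi * Real.exp u * Real.exp v := by positivity
  linarith

theorem corollary4p1 (m n : ℕ) (hm : 1 ≤ m) (hmn : m ≤ n) (r : ℝ) (hr : 0 < r) :
    sphereMeasure n ((openNeighbourhood r (greatSubsphere (n - m) n))ᶜ) ≤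
      ENNReal.ofReal
        (min
          (min (constA m * Real.exp (-(1 / (3 * Real.pi) * Real.sqrt (2 * (n : ℝ) / (m : ℝ)) * r)))
            (constATilde m * Real.exp (-(1 / (3 * Real.pi) * Real.sqrt ((n : ℝ) / (2 * (m : ℝ))) * r))))
          (min (constB m * Real.exp (-(((n : ℝ) - 1) / (4 * Real.pi ^ 2 * (m : ℝ)) * r ^ 2)))
            (constBTilde m * Real.exp (-(((n : ℝ) - 1) / (8 * Real.pi ^ 2 * (m : ℝ)) * r ^ 2))))) := by
  refine (sphereMeasure_compl_openNeighbourhood_le hm hmn hr).trans (ENNReal.ofReal_le_ofReal ?_)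
  have hm' : (1 : ℝ) ≤ m := by exact_mod_cast hm
  have hm0 : (0 : ℝ) < m := by linarith
  have hn' : (1 : ℝ) ≤ n := by exact_mod_cast hm.trans hmn
  have hpi := Real.pi_pos
  have hden : 0 < 4 * (m : ℝ) - 2 := by linarith
  have hexp : 0 ≤ ((m : ℝ) + 1) / (4 * (m : ℝ) - 2) := div_nonneg (by linarith) hden.le
  have hA : 1 / (3 * Real.pi) * Real.sqrt (2 * (n : ℝ) / (m : ℝ)) * r ≤
      (n + 1) * r ^ 2 / (2 * Real.pi ^ 2 * m) + 1 / 9 := by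
    set t := Real.sqrt (2 * (n : ℝ) / (m : ℝ)) * r / Real.pi
    have ht : t ^ 2 / 4 = n * r ^ 2 / (2 * Real.pi ^ 2 * m) := by
      rw [div_pow, mul_pow, Real.sq_sqrt (by positivity)]
      field_simp
      norm_num
    have h1 : 1 / (3 * Real.pi) * Real.sqrt (2 * (n : ℝ) / (m : ℝ)) * r = t / 3 := by
      simp only [t]
      field_simp
    have h2 : n * r ^ 2 / (2 * Real.pi ^ 2 * m) ≤ (n + 1) * r ^ 2 / (2 * Real.pi ^ 2 * m) := by
      gcongr
      linarith
    rw [h1]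
    -- Completing the square: `t / 3 ≤ t ^ 2 / 4 + 1 / 9`.
    nlinarith [sq_nonneg (t / 2 - 1 / 3)]
  have hATilde : 1 / (3 * Real.pi) * Real.sqrt ((n : ℝ) / (2 * (m : ℝ))) * r ≤
      1 / (3 * Real.pi) * Real.sqrt (2 * (n : ℝ) / (m : ℝ)) * r := by
    gcongr ?_ * Real.sqrt ?_ * r
    rw [div_le_div_iff₀ (by positivity) hm0]
    nlinarith [mul_pos hm0 (zero_lt_one.trans_le hn')]
  have hB : ((n : ℝ) - 1) / (4 * Real.pi ^ 2 * (m : ℝ)) * r ^ 2 ≤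
      (n + 1) * r ^ 2 / (2 * Real.pi ^ 2 * m) := by
    rw [div_mul_eq_mul_div]
    gcongr <;> linarith
  have hBTilde : ((n : ℝ) - 1) / (8 * Real.pi ^ 2 * (m : ℝ)) * r ^ 2 ≤
      (n + 1) * r ^ 2 / (2 * Real.pi ^ 2 * m) := by
    rw [div_mul_eq_mul_div]
    gcongr <;> linarith
  refine le_min (le_min ?_ ?_) (le_min ?_ ?_)
  · exact sqrt_two_mul_exp_neg_le (one_add_sqrt_pi_le_one_add_mul_exp_div_mul
      (div_nonneg (by linarith) hden.le)) hA
  · exact sqrt_two_mul_exp_neg_le (one_add_sqrt_pi_le_one_add_mul_exp_div_mul hexp)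
      (hATilde.trans hA)
  · exact sqrt_two_mul_exp_neg_le (one_add_sqrt_pi_le_one_add_mul_exp (by positivity))
      (by linarith)
  · exact sqrt_two_mul_exp_neg_le (one_add_sqrt_pi_le_one_add_mul_exp hexp) (by linarith)
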